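/- Let $n\ge 1$ and let $\mathcal K$ be a quantum channel on $n\times n$ complex matrices, i.e. $\mathcal K(\rho)=\sum_{j=1}^d K_j\rho K_j^\dagger$ for some $K_1,\dots,K_d\in\mathbb C^{n\times n}$ with $\sum_j K_j^\dagger K_j=I$. Let $B$ denote the $n$-dimensional system $\mathbb C^n$ and let $F(\rho,\sigma)=\operatorname{Tr}\sqrt{\rho^{1/2}\sigma\rho^{1/2}}$ be the Uhlmann fidelity. Define the minimum entanglement fidelity $$F_{\min}(\mathcal K)=\min_{|\Psi\rangle}F\bigl(|\Psi\rangle\langle\Psi|,\,(I_A\otimes\mathcal K_B)(|\Psi\rangle\langle\Psi|)\bigr),$$ where $|\Psi\rangle$ ranges over all unit vectors of $A\otimes B$ and over all finite-dimensional ancillas $A$. For a unitary matrix $U$ with eigenvalues $e^{-i\theta_1},\dots,e^{-i\theta_r}$, $\theta_j\in(-\pi,\pi]$, put $\|U\|_{\max}=\max_j|\theta_j|$, and define the time-energy cost of the channel $$\|\mathcal K\|_{\max}=\min_U\|U\|_{\max},$$ where $U$ ranges over all unitaries on $C\otimes B$, with $C$ any ancilla of finite dimension at least $1$ and with fixed basis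 state $|0\rangle_C$, such that $\mathcal K(\rho)=\operatorname{Tr}_C\bigl[U(|0\rangle\langle 0|\otimes\rho)U^\dagger\bigr]$ for all $\rho$. Then both minima are attained, and $$F_{\min}(\mathcal K)=\max\bigl(\cos\|\mathcal K\|_{\max},\,0\bigr).$$ -/

import Mathlib

open scoped Matrix Kronecker MatrixOrder

noncomputable section

namespace QuantumCost

/-- `K` is a quantum channel on `n`-dimensional systems: it has a Kraus representation
`K ρ = ∑ j, K_j ρ K_j†` with `∑ j, K_j† K_j = 1` (complete positivity and trace preservation). -/
def IsQuantumChannel {n : ℕ} (K : Matrix (Fin n) (Fin n) ℂ →ₗ[ℂ] Matrix (Fin n) (Fin n) ℂ) :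
    Prop :=
  ∃ (d : ℕ) (k : Fin d → Matrix (Fin n) (Fin n) ℂ),
    ∑ j, (k j)ᴴ * k j = 1 ∧ ∀ ρ, K ρ = ∑ j, k j * ρ * (k j)ᴴ

/-- The map `I_A ⊗ K`, acting on matrices over the joint system `AB`: apply `K` to each
`B`-block. -/
def idTensor {n : ℕ} (a : ℕ) (K : Matrix (Fin n) (Fin n) ℂ →ₗ[ℂ] Matrix (Fin n) (Fin n) ℂ)
    (M : Matrix (Fin a × Fin n) (Fin a × Fin n) ℂ) :
    Matrix (Fin a × Fin n) (Fin a × Fin n) ℂ :=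
  Matrix.of fun p q => K (Matrix.of fun i j => M (p.1, i) (q.1, j)) p.2 q.2

/-- The Uhlmann fidelity `Tr √(√ρ σ √ρ)` of two states `ρ`, `σ`. -/
def fidelity {ι : Type*} [Fintype ι] [DecidableEq ι] (ρ σ : Matrix ι ι ℂ) : ℝ :=
  (Matrix.trace (CFC.sqrt (CFC.sqrt ρ * σ * CFC.sqrt ρ))).re

/-- The rank-one operator `|Ψ⟩⟨Ψ|`. -/
def pureState {ι : Type*} (Ψ : ι → ℂ) : Matrix ι ι ℂ :=
  Matrix.vecMulVec Ψ (star Ψ)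

/-- The fidelities between the input `|Ψ⟩⟨Ψ|` and the output `(I_A ⊗ K)(|Ψ⟩⟨Ψ|)`, where `Ψ` runs
over the unit vectors of `AB` and the dimension `a` of the ancilla `A` is arbitrary. -/
def entanglementFidelities {n : ℕ}
    (K : Matrix (Fin n) (Fin n) ℂ →ₗ[ℂ] Matrix (Fin n) (Fin n) ℂ) : Set ℝ :=
  {f | ∃ (a : ℕ) (Ψ : Fin a × Fin n → ℂ), ∑ p, ‖Ψ p‖ ^ 2 = 1 ∧
    f = fidelity (pureState Ψ) (idTensor a K (pureState Ψ))}

/-- The minimum entanglement fidelity of `K`. -/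
def minEntanglementFidelity {n : ℕ}
    (K : Matrix (Fin n) (Fin n) ℂ →ₗ[ℂ] Matrix (Fin n) (Fin n) ℂ) : ℝ :=
  sInf (entanglementFidelities K)

/-- The time-energy cost of a unitary matrix: the largest `|θ|` for which `exp (-i θ)` is an
eigenvalue, the angles being taken in `(-π, π]`. -/
def unitaryCost {ι : Type*} [Fintype ι] [DecidableEq ι] (U : Matrix ι ι ℂ) : ℝ :=
  sSup {t | ∃ θ ∈ Set.Ioc (-Real.pi) Real.pi,
    Module.End.HasEigenvalue (Matrix.toLin' U) (Complex.exp (-(Complex.I * (θ : ℂ)))) ∧ t = |θ|}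

/-- The partial trace over the first factor `C` of a joint system `CB`. -/
def partialTraceLeft {ι κ : Type*} [Fintype ι] (M : Matrix (ι × κ) (ι × κ) ℂ) : Matrix κ κ ℂ :=
  Matrix.of fun i j => ∑ c, M (c, i) (c, j)

/-- `U`, acting on `CB` with `dim C = m + 1`, is a unitary dilation of `K`:
`K ρ = Tr_C [U (|0⟩⟨0| ⊗ ρ) U†]` for all `ρ`. Both sides being linear in `ρ`, it is the same to
quantify over density matrices or over all matrices. -/
def IsDilation {n m : ℕ} (K : Matrix (Fin n) (Fin n) ℂ →ₗ[ℂ] Matrix (Fin n) (Fin n) ℂ)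
    (U : Matrix (Fin (m + 1) × Fin n) (Fin (m + 1) × Fin n) ℂ) : Prop :=
  U ∈ Matrix.unitaryGroup (Fin (m + 1) × Fin n) ℂ ∧
    ∀ ρ : Matrix (Fin n) (Fin n) ℂ,
      K ρ = partialTraceLeft
        (U * (Matrix.single (0 : Fin (m + 1)) (0 : Fin (m + 1)) (1 : ℂ) ⊗ₖ ρ) * Uᴴ)

/-- The costs of all unitary dilations of `K`, with an ancilla `C` of any dimension. -/
def dilationCosts {n : ℕ}
    (K : Matrix (Fin n) (Fin n) ℂ →ₗ[ℂ] Matrix (Fin n) (Fin n) ℂ) : Set ℝ :=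
  {t | ∃ (m : ℕ) (U : Matrix (Fin (m + 1) × Fin n) (Fin (m + 1) × Fin n) ℂ),
    IsDilation K U ∧ t = unitaryCost U}

/-- The time-energy cost of `K`. -/
def timeEnergyCost {n : ℕ}
    (K : Matrix (Fin n) (Fin n) ℂ →ₗ[ℂ] Matrix (Fin n) (Fin n) ℂ) : ℝ :=
  sInf (dilationCosts K)

end QuantumCost

end

/-! For a Kraus family `k` and an input with reduced state `ρ` on `B`, the squared fidelity is `∑ j,
|tr (k_j ρ)|²`. Hence the minimum fidelity `f` is the distance from the origin to the compact convex
set of vectors `(tr (k_j ρ))_j`.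

Lower bound for the fidelity: a dilation `U` has first Kraus operator `l 0 = Jᴴ U J`, with `J x =
|0⟩ ⊗ x`. The numerical range of a unitary lies in the convex hull of its spectrum, so the real part
of `l 0` is at least `cos (unitaryCost U)`. The term of `l 0` alone then bounds the fidelity
(`cos_unitaryCost_le_of_isDilation`).

Converse: at the nearest point `w` of the convex set, the supporting half-space gives `Re ∑ j, conj
w_j k_j ≥ f²` (`sq_mul_le_re_of_isMinOn_overlap`). Divided by `f`, this combination has unit
coefficient vector, so unitary freedom makes it the first operator of another Kraus family
(`exists_kraus_certificate`). It remains to extend the resulting isometry to a unitary whose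
spectrum has real part at least `f`. The Cayley transform turns this into extending a symmetric
operator without increasing its norm bound, which is Krein's theorem (`exists_unitary_extension`,
`exists_isHermitian_extension`).

So the minimal cost is `arccos f`. As `f ≥ 0`, it never exceeds `π / 2`, and the maximum with 0
changes nothing. -/

open scoped Matrix Kronecker MatrixOrder

noncomputable section

namespace QuantumCost

open Matrix
open scoped ComplexOrder

/-! ### Entanglement fidelity in terms of Kraus operators -/

/-- The fidelity of a pure state with `σ` is the square root of the expectation value of `σ`. -/
theorem fidelity_pureState {ι : Type*} [Fintype ι] [DecidableEq ι] {Ψ : ι → ℂ}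
    (hΨ : ∑ p, ‖Ψ p‖ ^ 2 = 1) {σ : Matrix ι ι ℂ} {s : ℝ} (hs : 0 ≤ s)
    (hσ : star Ψ ⬝ᵥ σ *ᵥ Ψ = s) : fidelity (pureState Ψ) σ = √s := by
  have h1 : star Ψ ⬝ᵥ Ψ = 1 := by
    rw [dotProduct]
    simp only [Pi.star_apply, RCLike.star_def, Complex.conj_mul']
    exact_mod_cast hΨ
  have hpos : 0 ≤ pureState Ψ := nonneg_iff_posSemidef.2 (posSemidef_vecMulVec_self_star Ψ)
  have hidem : pureState Ψ * pureState Ψ = pureState Ψ := by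
    rw [pureState, vecMulVec_mul_vecMulVec, h1, one_smul]
  have hsand : pureState Ψ * σ * pureState Ψ = (s : ℂ) • pureState Ψ := by
    rw [pureState, vecMulVec_mul, vecMulVec_mul_vecMulVec, ← dotProduct_mulVec, hσ,
      vecMulVec_smul]
  have hsc : (0 : ℂ) ≤ ((√s : ℝ) : ℂ) := by exact_mod_cast Real.sqrt_nonneg s
  rw [fidelity, CFC.sqrt_unique hidem, hsand,
    CFC.sqrt_unique (b := ((√s : ℝ) : ℂ) • pureState Ψ) _ (smul_nonneg hsc hpos)]
  · rw [trace_smul, pureState, trace_vecMulVec, dotProduct_comm, h1]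
    simp
  · rw [smul_mul_smul_comm, hidem]
    congr 1
    exact_mod_cast Real.mul_self_sqrt hs

/-- The expectation value `⟨Ψ| I ⊗ A |Ψ⟩`. -/
def overlap {ι κ : Type*} [Fintype ι] [Fintype κ] (A : Matrix κ κ ℂ) (Ψ : ι × κ → ℂ) : ℂ :=
  ∑ α, star (fun i => Ψ (α, i)) ⬝ᵥ A *ᵥ (fun i => Ψ (α, i))

/-- The overlap depends on `Ψ` only through its reduced state, and linearly; this is the source of
convexity. -/
theorem overlap_eq_trace {ι κ : Type*} [Fintype ι] [Fintype κ] (A : Matrix κ κ ℂ)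
    (Ψ : ι × κ → ℂ) :
    overlap A Ψ =
      trace (A * ∑ α, vecMulVec (fun i => Ψ (α, i)) (star fun i => Ψ (α, i))) := by
  rw [Matrix.mul_sum, trace_sum, overlap]
  refine Finset.sum_congr rfl fun α _ => ?_
  rw [mul_vecMulVec, trace_vecMulVec, dotProduct_comm]

theorem overlap_one {ι κ : Type*} [Fintype ι] [Fintype κ] [DecidableEq κ] (Ψ : ι × κ → ℂ) :
    overlap 1 Ψ = ((∑ p, ‖Ψ p‖ ^ 2 : ℝ) : ℂ) := by
  rw [overlap, Fintype.sum_prod_type]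
  push_cast
  refine Finset.sum_congr rfl fun α _ => ?_
  simp [dotProduct, Complex.conj_mul']

/-- For each Kraus operator, the term of a pair of `A`-blocks is a product of a number and a
conjugate, so the double sum over blocks factors into a squared modulus. -/
theorem dotProduct_idTensor_mulVec {n a : ℕ} {ι : Type*} [Fintype ι]
    {K : Matrix (Fin n) (Fin n) ℂ →ₗ[ℂ] Matrix (Fin n) (Fin n) ℂ}
    {k : ι → Matrix (Fin n) (Fin n) ℂ} (hk : ∀ ρ, K ρ = ∑ j, k j * ρ * (k j)ᴴ)
    (Ψ : Fin a × Fin n → ℂ) :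
    star Ψ ⬝ᵥ idTensor a K (pureState Ψ) *ᵥ Ψ = ((∑ j, ‖overlap (k j) Ψ‖ ^ 2 : ℝ) : ℂ) := by
  have hblock (α β : Fin a) : (Matrix.of fun i j => pureState Ψ (α, i) (β, j)) =
      vecMulVec (fun i => Ψ (α, i)) (star fun i => Ψ (β, i)) := by
    ext i j
    simp [pureState, vecMulVec_apply]
  have hsplit : star Ψ ⬝ᵥ idTensor a K (pureState Ψ) *ᵥ Ψ =
      ∑ α, ∑ β, star (fun i => Ψ (α, i)) ⬝ᵥ
        K (vecMulVec (fun i => Ψ (α, i)) (star fun i => Ψ (β, i))) *ᵥ fun i => Ψ (β, i) := by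
    simp only [dotProduct, mulVec, Fintype.sum_prod_type, idTensor, of_apply, hblock,
      Finset.mul_sum, Pi.star_apply]
    refine Finset.sum_congr rfl fun α _ => ?_
    rw [Finset.sum_comm]
  have hterm (α β : Fin a) : star (fun i => Ψ (α, i)) ⬝ᵥ
      K (vecMulVec (fun i => Ψ (α, i)) (star fun i => Ψ (β, i))) *ᵥ (fun i => Ψ (β, i)) =
      ∑ j, (star (fun i => Ψ (α, i)) ⬝ᵥ k j *ᵥ fun i => Ψ (α, i)) *
        star (star (fun i => Ψ (β, i)) ⬝ᵥ k j *ᵥ fun i => Ψ (β, i)) := by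
    rw [hk, sum_mulVec, dotProduct_sum]
    refine Finset.sum_congr rfl fun j _ => ?_
    rw [mul_vecMulVec, vecMulVec_mul, vecMulVec_mulVec, dotProduct_smul, ← star_mulVec,
      star_dotProduct (k j *ᵥ _), op_smul_eq_mul]
  rw [hsplit]
  simp_rw [hterm]
  push_cast
  simp_rw [← Complex.mul_conj', overlap, map_sum, Finset.sum_mul_sum]
  rw [Finset.sum_congr rfl fun α _ => Finset.sum_comm, Finset.sum_comm]
  rfl

theorem fidelity_idTensor {n a : ℕ} {ι : Type*} [Fintype ι]
    {K : Matrix (Fin n) (Fin n) ℂ →ₗ[ℂ] Matrix (Fin n) (Fin n) ℂ}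
    {k : ι → Matrix (Fin n) (Fin n) ℂ} (hk : ∀ ρ, K ρ = ∑ j, k j * ρ * (k j)ᴴ)
    {Ψ : Fin a × Fin n → ℂ} (hΨ : ∑ p, ‖Ψ p‖ ^ 2 = 1) :
    fidelity (pureState Ψ) (idTensor a K (pureState Ψ)) = √(∑ j, ‖overlap (k j) Ψ‖ ^ 2) :=
  fidelity_pureState hΨ (by positivity) (dotProduct_idTensor_mulVec hk Ψ)

/-- Every positive semidefinite `ρ` has a purification with an ancilla as large as the system. -/
theorem exists_overlap_eq_trace {κ : Type*} [Fintype κ] [DecidableEq κ] {ρ : Matrix κ κ ℂ}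
    (hρ : ρ.PosSemidef) :
    ∃ Ψ : κ × κ → ℂ, ∀ A : Matrix κ κ ℂ, overlap A Ψ = trace (A * ρ) := by
  obtain ⟨B, rfl⟩ := CStarAlgebra.nonneg_iff_eq_star_mul_self.1 (nonneg_iff_posSemidef.2 hρ)
  -- With `ρ = Bᴴ B`, the conjugated rows of `B` are the components of the purification: `ρ` is the
  -- sum of their rank-one operators.
  refine ⟨fun p => star (B p.1 p.2), fun A => ?_⟩
  rw [overlap_eq_trace]
  congr 2
  ext i j
  simp [Matrix.sum_apply, vecMulVec_apply, Matrix.mul_apply, star_eq_conjTranspose]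

theorem continuous_overlap {ι κ : Type*} [Fintype ι] [Fintype κ] (A : Matrix κ κ ℂ) :
    Continuous fun Ψ : ι × κ → ℂ => overlap A Ψ := by
  unfold overlap dotProduct mulVec dotProduct
  simp only [Pi.star_apply]
  fun_prop

theorem isCompact_unit_vectors (ι : Type*) [Fintype ι] :
    IsCompact {Ψ : ι → ℂ | ∑ p, ‖Ψ p‖ ^ 2 = 1} := by
  refine Metric.isCompact_of_isClosed_isBounded (isClosed_eq (by fun_prop) continuous_const) ?_
  refine (Metric.isBounded_closedBall (x := (0 : ι → ℂ)) (r := 1)).subset fun Ψ hΨ => ?_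
  rw [mem_closedBall_zero_iff, pi_norm_le_iff_of_nonneg zero_le_one]
  intro i
  have := Finset.single_le_sum (f := fun p => ‖Ψ p‖ ^ 2) (fun p _ => by positivity)
    (Finset.mem_univ i)
  rw [Set.mem_ofPred_eq] at hΨ
  rw [hΨ] at this
  exact (sq_le_one_iff₀ (norm_nonneg _)).1 this

/-- Here `w` is the point of the segment from `w` to `z` nearest to the origin, and the obtuse-angle
criterion for projections onto convex sets applies. -/
theorem norm_sq_le_inner_of_forall_norm_le {E : Type*} [NormedAddCommGroup E]
    [InnerProductSpace ℝ E] {w z : E}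
    (h : ∀ t ∈ Set.Icc (0 : ℝ) 1, ‖w‖ ≤ ‖(1 - t) • w + t • z‖) : ‖w‖ ^ 2 ≤ inner ℝ w z := by
  have key : inner ℝ (0 - w) (z - w) ≤ 0 := by
    refine (norm_eq_iInf_iff_real_inner_le_zero (convex_segment w z)
      (left_mem_segment ℝ w z)).1 ?_ z (right_mem_segment ℝ w z)
    have : Nonempty (segment ℝ w z) := ⟨⟨w, left_mem_segment ℝ w z⟩⟩
    refine le_antisymm (le_ciInf fun x => ?_)
      (ciInf_le ⟨0, by rintro _ ⟨x, rfl⟩; positivity⟩ (⟨w, left_mem_segment ℝ w z⟩ : segment ℝ w z))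
    obtain ⟨x, a, b, ha, hb, hab, rfl⟩ := x
    have := h b ⟨hb, by linarith⟩
    rw [← hab, add_sub_cancel_right] at this
    simpa only [zero_sub, norm_neg] using this
  rw [zero_sub, inner_neg_left, inner_sub_right, real_inner_self_eq_norm_sq] at key
  linarith

/-! ### Spectrum, numerical range and cost of a unitary -/

open scoped Matrix.Norms.L2Operator in
-- A unitary is normal, so the matrix is `z ↦ 2 Re z - 2c` applied to `U`, and this function is
-- nonnegative on the spectrum.
theorem smul_one_le_of_eigenvalues {ι : Type*} [Fintype ι] [DecidableEq ι] {U : Matrix ι ι ℂ}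
    (hU : U ∈ unitaryGroup ι ℂ) {c : ℝ} (hc : ∀ z ∈ spectrum ℂ U, c ≤ z.re) :
    (0 : Matrix ι ι ℂ) ≤ U + star U - (2 * c : ℂ) • 1 := by
  have hn : IsStarNormal U := ⟨by
    rw [commute_iff_eq, mem_unitaryGroup_iff.1 hU, mem_unitaryGroup_iff'.1 hU]⟩
  have : U + star U - (2 * c : ℂ) • 1 = cfc (fun z : ℂ => z + star z - 2 * c) U := by
    rw [cfc_sub (fun z : ℂ => z + star z) (fun _ => 2 * (c : ℂ)) U,
      cfc_add U (fun z : ℂ => z) (fun z => star z), cfc_id' ℂ U, cfc_star_id (a := U), cfc_const _ U,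
      Algebra.algebraMap_eq_smul_one]
  rw [this]
  refine cfc_nonneg fun z hz => ?_
  have := hc z hz
  rw [RCLike.star_def, Complex.add_conj]
  exact_mod_cast (by linarith : (0 : ℝ) ≤ 2 * z.re - 2 * c)

theorem norm_eq_one_of_mem_spectrum {ι : Type*} [Fintype ι] [DecidableEq ι] {U : Matrix ι ι ℂ}
    (hU : U ∈ unitaryGroup ι ℂ) {z : ℂ} (hz : z ∈ spectrum ℂ U) : ‖z‖ = 1 := by
  open scoped Matrix.Norms.L2Operator in
  simpa using spectrum.subset_circle_of_unitary hU hz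

theorem unitaryCost_bddAbove {ι : Type*} [Fintype ι] [DecidableEq ι] (U : Matrix ι ι ℂ) :
    BddAbove {t | ∃ θ ∈ Set.Ioc (-Real.pi) Real.pi,
      Module.End.HasEigenvalue (Matrix.toLin' U) (Complex.exp (-(Complex.I * (θ : ℂ)))) ∧
        t = |θ|} := by
  refine ⟨Real.pi, ?_⟩
  rintro _ ⟨θ, hθ, -, rfl⟩
  exact abs_le.2 ⟨hθ.1.le, hθ.2⟩

theorem unitaryCost_nonneg {ι : Type*} [Fintype ι] [DecidableEq ι] (U : Matrix ι ι ℂ) :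
    0 ≤ unitaryCost U := by
  refine Real.sSup_nonneg ?_
  rintro _ ⟨θ, -, -, rfl⟩
  positivity

theorem unitaryCost_le_pi {ι : Type*} [Fintype ι] [DecidableEq ι] (U : Matrix ι ι ℂ) :
    unitaryCost U ≤ Real.pi := by
  refine Real.sSup_le ?_ Real.pi_pos.le
  rintro _ ⟨θ, hθ, -, rfl⟩
  exact abs_le.2 ⟨hθ.1.le, hθ.2⟩

theorem cos_unitaryCost_le_re {ι : Type*} [Fintype ι] [DecidableEq ι] {U : Matrix ι ι ℂ}
    (hU : U ∈ unitaryGroup ι ℂ) {z : ℂ} (hz : z ∈ spectrum ℂ U) :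
    Real.cos (unitaryCost U) ≤ z.re := by
  have h1 := norm_eq_one_of_mem_spectrum hU hz
  -- Eigenvalues are written `exp (-iθ)`, so `θ` is the argument of the conjugate of `z`; this
  -- choice also gives `θ = π` at `z = -1`.
  obtain ⟨θ, hθ, hzθ⟩ : ∃ θ ∈ Set.Ioc (-Real.pi) Real.pi,
      z = Complex.exp (-(Complex.I * (θ : ℂ))) := by
    have h1' : ‖star z‖ = 1 := by rw [norm_star, h1]
    refine ⟨(star z).arg, Complex.arg_mem_Ioc _, ?_⟩
    have := Complex.norm_mul_exp_arg_mul_I (star z)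
    rw [h1', Complex.ofReal_one, one_mul] at this
    conv_lhs => rw [← star_star z, ← this]
    rw [RCLike.star_def, ← Complex.exp_conj, map_mul, Complex.conj_ofReal, Complex.conj_I]
    congr 1
    ring
  have hle : |θ| ≤ unitaryCost U := by
    refine le_csSup (unitaryCost_bddAbove U) ⟨θ, hθ, ?_, rfl⟩
    rwa [Module.End.hasEigenvalue_iff_mem_spectrum, spectrum_toLin', ← hzθ]
  have hre : z.re = Real.cos |θ| := by
    rw [hzθ, Real.cos_abs, Complex.exp_re]
    simp
  rw [hre]
  exact Real.cos_le_cos_of_nonneg_of_le_pi (abs_nonneg _) (unitaryCost_le_pi U) hle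

theorem cos_unitaryCost_mul_le {ι : Type*} [Fintype ι] [DecidableEq ι] {U : Matrix ι ι ℂ}
    (hU : U ∈ unitaryGroup ι ℂ) (x : ι → ℂ) :
    Real.cos (unitaryCost U) * (star x ⬝ᵥ x).re ≤ (star x ⬝ᵥ U *ᵥ x).re := by
  have h := (nonneg_iff_posSemidef.1 (smul_one_le_of_eigenvalues hU
    fun z hz => cos_unitaryCost_le_re hU hz)).dotProduct_mulVec_nonneg x
  have h2 : star x ⬝ᵥ star U *ᵥ x = star (star x ⬝ᵥ U *ᵥ x) := by
    rw [star_dotProduct, star_eq_conjTranspose, star_mulVec, conjTranspose_conjTranspose,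
      ← dotProduct_mulVec]
  rw [sub_mulVec, add_mulVec, dotProduct_sub, dotProduct_add, h2, smul_mulVec, one_mulVec,
    dotProduct_smul, RCLike.star_def, Complex.add_conj, smul_eq_mul] at h
  have h3 := (Complex.le_def.1 h).1
  rw [← Complex.ofReal_ofNat, ← Complex.ofReal_mul, Complex.sub_re, Complex.re_ofReal_mul] at h3
  simp at h3
  linarith

theorem unitaryCost_le_arccos {ι : Type*} [Fintype ι] [DecidableEq ι] {U : Matrix ι ι ℂ} {c : ℝ}
    (hc : ∀ z ∈ spectrum ℂ U, ‖z‖ = 1 → c ≤ z.re) : unitaryCost U ≤ Real.arccos c := by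
  refine Real.sSup_le ?_ (Real.arccos_nonneg c)
  rintro _ ⟨θ, hθ, h, rfl⟩
  rw [Module.End.hasEigenvalue_iff_mem_spectrum, spectrum_toLin'] at h
  have hre := hc _ h (by simp [Complex.norm_exp])
  have : c ≤ Real.cos |θ| := by
    rw [Real.cos_abs]
    simpa [Complex.exp_re] using hre
  rw [← Real.arccos_cos (abs_nonneg θ) (abs_le.2 ⟨hθ.1.le, hθ.2⟩)]
  exact Real.arccos_le_arccos this

/-! ### Extension of symmetric operators and of isometries -/

/-- A Hermitian matrix has a Hermitian pseudoinverse. -/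
theorem exists_pseudoinverse {ι : Type*} [Fintype ι] [DecidableEq ι] {Q : Matrix ι ι ℂ}
    (hQ : Q.IsHermitian) :
    ∃ R : Matrix ι ι ℂ, R.IsHermitian ∧ Q * R * Q = Q ∧ R * Q * R = R := by
  have hsa : IsSelfAdjoint Q := hQ
  have hfin : (spectrum ℝ Q).Finite := Matrix.finite_real_spectrum
  have hcont (f : ℝ → ℝ) : ContinuousOn f (spectrum ℝ Q) := hfin.continuousOn f
  -- The convention `0⁻¹ = 0` inverts the nonzero eigenvalues and keeps the kernel; continuity is
  -- free on a finite spectrum.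
  refine ⟨cfc (fun x : ℝ => x⁻¹) Q, cfc_predicate (fun x : ℝ => x⁻¹) Q, ?_, ?_⟩
  · have h : cfc (fun x : ℝ => x * x⁻¹ * x) Q =
        cfc (fun x : ℝ => x) Q * cfc (fun x : ℝ => x⁻¹) Q * cfc (fun x : ℝ => x) Q := by
      rw [cfc_mul _ _ Q (hcont _) (hcont _), cfc_mul _ _ Q (hcont _) (hcont _)]
    simp only [mul_inv_mul_cancel, cfc_id' ℝ Q] at h
    exact h.symm
  · have h : cfc (fun x : ℝ => x⁻¹ * x * x⁻¹) Q =
        cfc (fun x : ℝ => x⁻¹) Q * cfc (fun x : ℝ => x) Q * cfc (fun x : ℝ => x⁻¹) Q := by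
      rw [cfc_mul _ _ Q (hcont _) (hcont _), cfc_mul _ _ Q (hcont _) (hcont _)]
    have hinv (x : ℝ) : x⁻¹ * x * x⁻¹ = x⁻¹ := by
      by_cases hx : x = 0 <;> simp [hx]
    simp only [hinv, cfc_id' ℝ Q] at h
    exact h.symm

/-- Krein's extension theorem: a symmetric operator of norm at most `τ`, given on the range of `X`
by `X x ↦ Y x`, extends to a Hermitian matrix of norm at most `τ`. -/
theorem exists_isHermitian_extension {ι κ : Type*} [Fintype ι] [DecidableEq ι] [Fintype κ]
    [DecidableEq κ] {X Y : Matrix ι κ ℂ} {τ : ℝ} (hXY : (Xᴴ * Y).IsHermitian)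
    (hle : Yᴴ * Y ≤ ((τ : ℂ) ^ 2) • (Xᴴ * X)) :
    ∃ T : Matrix ι ι ℂ, T.IsHermitian ∧ T * X = Y ∧ T * T ≤ ((τ : ℂ) ^ 2) • 1 := by
  have hYX : Yᴴ * X = Xᴴ * Y := by
    rw [← hXY.eq, conjTranspose_mul, conjTranspose_conjTranspose]
  have hτ' : star (τ : ℂ) = τ := Complex.conj_ofReal τ
  -- The shift `N = T + τ` replaces the bound `T² ≤ τ²` by `N² ≤ 2τN` and the condition `T X = Y` by
  -- `N X = Z`.
  set Z := Y + (τ : ℂ) • X with hZ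
  have hZX : Zᴴ * X = Xᴴ * Z := by
    simp [hZ, Matrix.add_mul, Matrix.mul_add, hYX, conjTranspose_smul]
  have hQ : (Xᴴ * Z).IsHermitian := by
    rw [IsHermitian, conjTranspose_mul, conjTranspose_conjTranspose, hZX]
  have hZZ : (((2 * τ : ℝ) : ℂ) • (Xᴴ * Z) - Zᴴ * Z).PosSemidef := by
    have : ((2 * τ : ℝ) : ℂ) • (Xᴴ * Z) - Zᴴ * Z = ((τ : ℂ) ^ 2) • (Xᴴ * X) - Yᴴ * Y := by
      simp only [hZ, Matrix.add_mul, Matrix.mul_add, hYX, conjTranspose_smul, conjTranspose_add,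
        hτ', Matrix.smul_mul, Matrix.mul_smul]
      push_cast
      module
    rw [this]
    exact hle
  obtain ⟨R, hR, hQRQ, hRQR⟩ := exists_pseudoinverse hQ
  -- The bound `Zᴴ Z ≤ 2τ Xᴴ Z` forces `Z` to vanish on the kernel of `Xᴴ Z`, which contains the
  -- range of `W`.
  have hker : Z * (R * (Xᴴ * Z)) = Z := by
    set W := R * (Xᴴ * Z) - 1 with hW
    have h0 : (Xᴴ * Z) * W = 0 := by
      rw [hW, Matrix.mul_sub, ← Matrix.mul_assoc, hQRQ, Matrix.mul_one, sub_self]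
    have h1 := hZZ.conjTranspose_mul_mul_same W
    have h2 : Wᴴ * (((2 * τ : ℝ) : ℂ) • (Xᴴ * Z) - Zᴴ * Z) * W = -((Z * W)ᴴ * (Z * W)) := by
      rw [Matrix.mul_assoc, Matrix.sub_mul, Matrix.smul_mul, h0, conjTranspose_mul]
      simp [Matrix.mul_assoc]
    rw [h2, ← nonneg_iff_posSemidef] at h1
    have h3 : (Z * W)ᴴ * (Z * W) = 0 := le_antisymm (neg_nonneg.1 h1)
      (nonneg_iff_posSemidef.2 (posSemidef_conjTranspose_mul_self _))
    rw [conjTranspose_mul_self_eq_zero, hW, Matrix.mul_sub, Matrix.mul_one, sub_eq_zero] at h3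
    exact h3
  set N := Z * R * Zᴴ with hN
  have hNherm : N.IsHermitian := by
    rw [IsHermitian, hN]
    simp [conjTranspose_mul, hR.eq, Matrix.mul_assoc]
  have hNX : N * X = Z := by
    rw [hN, Matrix.mul_assoc, hZX, Matrix.mul_assoc, hker]
  -- This is the bound `hZZ` conjugated by `Z * R`.
  have hNN : (((2 * τ : ℝ) : ℂ) • N - N * N).PosSemidef := by
    have h1 := hZZ.mul_mul_conjTranspose_same (Z * R)
    have h2 : Z * R * (((2 * τ : ℝ) : ℂ) • (Xᴴ * Z) - Zᴴ * Z) * (Z * R)ᴴ =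
        ((2 * τ : ℝ) : ℂ) • N - N * N := by
      rw [Matrix.mul_sub, Matrix.sub_mul, Matrix.mul_smul, Matrix.smul_mul, conjTranspose_mul,
        hR.eq]
      congr 1
      · congr 1
        calc Z * R * (Xᴴ * Z) * (R * Zᴴ) = Z * (R * (Xᴴ * Z) * R) * Zᴴ := by
              simp only [Matrix.mul_assoc]
          _ = N := by rw [hRQR]
      · simp only [hN, Matrix.mul_assoc]
    rwa [h2] at h1
  refine ⟨N - (τ : ℂ) • 1, ?_, ?_, ?_⟩
  · rw [IsHermitian, conjTranspose_sub, hNherm.eq, conjTranspose_smul, conjTranspose_one, hτ']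
  · rw [Matrix.sub_mul, hNX, hZ, Matrix.smul_mul, Matrix.one_mul, add_sub_cancel_right]
  · rw [le_iff]
    have hsq : ((τ : ℂ) ^ 2) • 1 - (N - (τ : ℂ) • 1) * (N - (τ : ℂ) • 1) =
        ((2 * τ : ℝ) : ℂ) • N - N * N := by
      simp only [Matrix.sub_mul, Matrix.mul_sub, Matrix.smul_mul, Matrix.mul_smul, Matrix.one_mul,
        Matrix.mul_one]
      push_cast
      module
    rwa [hsq]

/-- Put `U = (1 - iT)(1 + iT)⁻¹` with `T` Hermitian. Solving `(1 + iT) X = J` and `(1 - iT) X = V`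
with `T X = Y` gives `X = (J + V) / 2` and `Y = (J - V) / (2i)`. The hypothesis on `Jᴴ V + Vᴴ J` is
then exactly the norm bound needed to extend `X x ↦ Y x` to such a `T`. -/
theorem exists_unitary_extension {ι κ : Type*} [Fintype ι] [DecidableEq ι] [Fintype κ]
    [DecidableEq κ] {J V : Matrix ι κ ℂ} (hJ : Jᴴ * J = 1) (hV : Vᴴ * V = 1) {c : ℝ}
    (hc0 : 0 ≤ c) (hc1 : c ≤ 1) (h : ((Jᴴ * V + Vᴴ * J) - (2 * c : ℂ) • 1).PosSemidef) :
    ∃ U ∈ unitaryGroup ι ℂ, U * J = V ∧ ∀ z ∈ spectrum ℂ U, ‖z‖ = 1 → c ≤ z.re := by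
  -- If `c = cos θ` with `θ` in `[0, π / 2]`, this is `tan (θ / 2)`, the Cayley image of the angle.
  set τ := √((1 - c) / (1 + c)) with hτdef
  have hτ2 : τ ^ 2 * (1 + c) = 1 - c := by
    rw [hτdef, Real.sq_sqrt (div_nonneg (by linarith) (by linarith))]
    field_simp
  set X := (1 / 2 : ℂ) • (J + V) with hX
  set Y := (-(Complex.I / 2)) • (J - V) with hY
  have hsI : star (-(Complex.I / 2)) = Complex.I / 2 := by simp [neg_div]
  have hs2 : star (1 / 2 : ℂ) = 1 / 2 := by simp
  have hXY : (Xᴴ * Y).IsHermitian := by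
    have hcalc : Xᴴ * Y = (Complex.I / 4) • (Jᴴ * V - Vᴴ * J) := by
      simp only [hX, hY, conjTranspose_smul, conjTranspose_add, Matrix.smul_mul, Matrix.mul_smul,
        Matrix.add_mul, Matrix.mul_sub, hJ, hV, hs2]
      module
    have hs4 : star (Complex.I / 4) = -(Complex.I / 4) := by simp [neg_div]
    rw [IsHermitian, hcalc, conjTranspose_smul, conjTranspose_sub, conjTranspose_mul,
      conjTranspose_mul, conjTranspose_conjTranspose, conjTranspose_conjTranspose, hs4]
    module
  have hle : Yᴴ * Y ≤ ((τ : ℂ) ^ 2) • (Xᴴ * X) := by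
    have hcalc : ((τ : ℂ) ^ 2) • (Xᴴ * X) - Yᴴ * Y =
        (((1 + τ ^ 2) / 4 : ℝ) : ℂ) • ((Jᴴ * V + Vᴴ * J) - (2 * c : ℂ) • 1) := by
      have hYY : Yᴴ * Y = (1 / 4 : ℂ) • ((2 : ℂ) • 1 - (Jᴴ * V + Vᴴ * J)) := by
        have hI : Complex.I / 2 * -(Complex.I / 2) = 1 / 4 := by
          linear_combination (-1 / 4 : ℂ) * Complex.I_mul_I
        rw [hY, conjTranspose_smul, Matrix.smul_mul, Matrix.mul_smul, smul_smul, hsI, hI, conjTranspose_sub,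
          Matrix.sub_mul, Matrix.mul_sub, Matrix.mul_sub, hJ, hV]
        module
      have hXX : Xᴴ * X = (1 / 4 : ℂ) • ((2 : ℂ) • 1 + (Jᴴ * V + Vᴴ * J)) := by
        simp only [hX, conjTranspose_smul, conjTranspose_add, Matrix.smul_mul, Matrix.mul_smul,
          Matrix.add_mul, Matrix.mul_add, hJ, hV, hs2]
        module
      have hτC : (τ : ℂ) ^ 2 * (1 + c) = 1 - c := by exact_mod_cast hτ2
      rw [hXX, hYY]
      push_cast
      match_scalars
      · linear_combination (1 / 2 : ℂ) * hτC
      · ring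
      · ring
    rw [le_iff, hcalc]
    refine h.smul ?_
    exact_mod_cast (by positivity : (0 : ℝ) ≤ (1 + τ ^ 2) / 4)
  obtain ⟨T, hT, hTX, hTT⟩ := exists_isHermitian_extension hXY hle
  set P := 1 + Complex.I • T with hP
  have hPH : Pᴴ = 1 - Complex.I • T := by
    simp [hP, conjTranspose_smul, hT.eq, sub_eq_add_neg]
  have hPP : Pᴴ * P = 1 + T * T := by
    rw [hPH, hP]
    simp only [Matrix.sub_mul, Matrix.mul_add, Matrix.smul_mul, Matrix.mul_smul, Matrix.one_mul,
      Matrix.mul_one]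
    match_scalars
    all_goals first | ring1 | linear_combination -Complex.I_mul_I
  have hPP' : P * Pᴴ = 1 + T * T := by
    rw [hPH, hP]
    simp only [Matrix.add_mul, Matrix.mul_sub, Matrix.smul_mul, Matrix.mul_smul, Matrix.one_mul,
      Matrix.mul_one]
    match_scalars
    all_goals first | ring1 | linear_combination -Complex.I_mul_I
  have hTTpos : (T * T).PosSemidef := by
    have := posSemidef_conjTranspose_mul_self T
    rwa [hT.eq] at this
  have hdet : IsUnit P.det := by
    have h1 : IsUnit (Pᴴ * P).det := by
      rw [← isUnit_iff_isUnit_det, hPP]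
      exact (PosDef.one.add_posSemidef hTTpos).isUnit
    rw [det_mul] at h1
    exact isUnit_of_mul_isUnit_right h1
  have hUP : Pᴴ * P⁻¹ * P = Pᴴ := by
    rw [Matrix.mul_assoc, nonsing_inv_mul P hdet, Matrix.mul_one]
  refine ⟨Pᴴ * P⁻¹, ?_, ?_, ?_⟩
  · rw [mem_unitaryGroup_iff', star_eq_conjTranspose, conjTranspose_mul,
      conjTranspose_conjTranspose]
    calc P⁻¹ᴴ * P * (Pᴴ * P⁻¹) = P⁻¹ᴴ * (P * Pᴴ) * P⁻¹ := by simp only [Matrix.mul_assoc]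
      _ = (P⁻¹ᴴ * Pᴴ) * (P * P⁻¹) := by rw [hPP', ← hPP]; simp only [Matrix.mul_assoc]
      _ = 1 := by rw [← conjTranspose_mul, mul_nonsing_inv P hdet]; simp
  · have hPX : P * X = J := by
      rw [hP, Matrix.add_mul, Matrix.one_mul, Matrix.smul_mul, hTX, hX, hY, smul_smul]
      have : Complex.I * -(Complex.I / 2) = 1 / 2 := by
        linear_combination (-1 / 2 : ℂ) * Complex.I_mul_I
      rw [this]
      module
    have hPHX : Pᴴ * X = V := by
      rw [hPH, Matrix.sub_mul, Matrix.one_mul, Matrix.smul_mul, hTX, hX, hY, smul_smul]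
      have : Complex.I * -(Complex.I / 2) = 1 / 2 := by
        linear_combination (-1 / 2 : ℂ) * Complex.I_mul_I
      rw [this]
      module
    rw [← hPX, ← Matrix.mul_assoc, hUP, hPHX]
  · intro z hz hz1
    rw [← spectrum_toLin', ← Module.End.hasEigenvalue_iff_mem_spectrum] at hz
    obtain ⟨v, hv⟩ := hz.exists_hasEigenvector
    have hUv : (Pᴴ * P⁻¹) *ᵥ v = z • v := by simpa using hv.apply_eq_smul
    set w := P⁻¹ *ᵥ v with hw
    have hPw : P *ᵥ w = v := by rw [hw, mulVec_mulVec, mul_nonsing_inv P hdet, one_mulVec]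
    have hw0 : w ≠ 0 := by
      rintro h0
      rw [h0, mulVec_zero] at hPw
      exact hv.2 hPw.symm
    -- In terms of `w`, the eigenvalue equation and the norm bound on `T` give `|1 - z| ≤ τ |1 +
    -- z|`, which on the unit circle means `c ≤ Re z`.
    have hrel : (1 - z) • w = (Complex.I * (1 + z)) • T *ᵥ w := by
      have h1 : Pᴴ *ᵥ w = z • P *ᵥ w := by
        rw [hPw, ← hUv, hw, mulVec_mulVec]
      rw [hPH, hP, sub_mulVec, add_mulVec, smul_mulVec, one_mulVec] at h1
      rw [← sub_eq_zero] at h1 ⊢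
      rw [← h1]
      module
    have hww : 0 < (star w ⬝ᵥ w).re := (Complex.lt_def.1 (dotProduct_star_self_pos_iff.2 hw0)).1
    have hTw : (star (T *ᵥ w) ⬝ᵥ T *ᵥ w).re ≤ τ ^ 2 * (star w ⬝ᵥ w).re := by
      have h1 := (Complex.le_def.1 ((le_iff.1 hTT).dotProduct_mulVec_nonneg w)).1
      rw [sub_mulVec, smul_mulVec, one_mulVec, dotProduct_sub, dotProduct_smul, ← mulVec_mulVec,
        smul_eq_mul, ← Complex.ofReal_pow, Complex.sub_re, Complex.re_ofReal_mul] at h1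
      rw [star_mulVec, hT.eq, ← dotProduct_mulVec]
      simpa using h1
    have hnorm : ‖1 - z‖ ^ 2 * (star w ⬝ᵥ w).re =
        ‖1 + z‖ ^ 2 * (star (T *ᵥ w) ⬝ᵥ T *ᵥ w).re := by
      have h1 : star ((1 - z) • w) ⬝ᵥ ((1 - z) • w) =
          star ((Complex.I * (1 + z)) • T *ᵥ w) ⬝ᵥ ((Complex.I * (1 + z)) • T *ᵥ w) := by
        rw [hrel]
      simp only [star_smul, smul_dotProduct, dotProduct_smul, smul_eq_mul,
        ← mul_assoc] at h1
      rw [RCLike.star_def, Complex.mul_conj', Complex.mul_conj',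
        ← Complex.ofReal_pow, ← Complex.ofReal_pow] at h1
      have h2 := congrArg Complex.re h1
      rwa [Complex.re_ofReal_mul, Complex.re_ofReal_mul, norm_mul, Complex.norm_I, one_mul] at h2
    have hz2 : z.re ^ 2 + z.im ^ 2 = 1 := by
      have := Complex.sq_norm z
      rw [hz1, Complex.normSq_apply] at this
      linarith
    have hm : ‖1 - z‖ ^ 2 = 2 - 2 * z.re := by
      rw [Complex.sq_norm, Complex.normSq_apply]
      simp
      linarith
    have hp : ‖1 + z‖ ^ 2 = 2 + 2 * z.re := by
      rw [Complex.sq_norm, Complex.normSq_apply]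
      simp
      linarith
    have hfin : (2 - 2 * z.re) * (star w ⬝ᵥ w).re ≤
        (2 + 2 * z.re) * τ ^ 2 * (star w ⬝ᵥ w).re := by
      rw [← hm, hnorm, hp, mul_assoc]
      exact mul_le_mul_of_nonneg_left hTw (by rw [← hp]; positivity)
    have := le_of_mul_le_mul_right hfin hww
    have h3 := mul_le_mul_of_nonneg_right this (by linarith : 0 ≤ 1 + c)
    have h4 : (2 + 2 * z.re) * τ ^ 2 * (1 + c) = (2 + 2 * z.re) * (1 - c) := by
      rw [mul_assoc, hτ2]
    linarith

/-! ### Dilations as unitary extensions of Kraus isometries -/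

/-- The embedding `x ↦ |0⟩ ⊗ x`. -/
def zeroEmbedding (m n : ℕ) : Matrix (Fin (m + 1) × Fin n) (Fin n) ℂ :=
  Matrix.of fun p j => if p.1 = 0 then (1 : Matrix (Fin n) (Fin n) ℂ) p.2 j else 0

/-- The operator `x ↦ ∑ c, |c⟩ ⊗ k_c x`. -/
def stack {m n : ℕ} (k : Fin m → Matrix (Fin n) (Fin n) ℂ) : Matrix (Fin m × Fin n) (Fin n) ℂ :=
  Matrix.of fun p j => k p.1 p.2 j

theorem zeroEmbedding_conjTranspose_mul_stack {m n : ℕ}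
    (k : Fin (m + 1) → Matrix (Fin n) (Fin n) ℂ) : (zeroEmbedding m n)ᴴ * stack k = k 0 := by
  ext i j
  simp [Matrix.mul_apply, Fintype.sum_prod_type, zeroEmbedding, stack, Matrix.one_apply,
    apply_ite]

theorem stack_conjTranspose_mul_stack {m n : ℕ} (k : Fin m → Matrix (Fin n) (Fin n) ℂ) :
    (stack k)ᴴ * stack k = ∑ c, (k c)ᴴ * k c := by
  ext i j
  simp [Matrix.mul_apply, Fintype.sum_prod_type, stack, Matrix.sum_apply]

theorem zeroEmbedding_eq_stack (m n : ℕ) :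
    zeroEmbedding m n = stack (Pi.single 0 1) := by
  ext p j
  by_cases h : p.1 = 0 <;> simp [zeroEmbedding, stack, h]

theorem zeroEmbedding_conjTranspose_mul_self (m n : ℕ) :
    (zeroEmbedding m n)ᴴ * zeroEmbedding m n = 1 := by
  have := zeroEmbedding_conjTranspose_mul_stack (m := m) (n := n) (Pi.single 0 1)
  rwa [← zeroEmbedding_eq_stack, Pi.single_eq_same] at this

theorem zeroEmbedding_mul_mul_conjTranspose {m n : ℕ} (ρ : Matrix (Fin n) (Fin n) ℂ) :
    zeroEmbedding m n * ρ * (zeroEmbedding m n)ᴴ =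
      Matrix.single (0 : Fin (m + 1)) (0 : Fin (m + 1)) (1 : ℂ) ⊗ₖ ρ := by
  ext ⟨c, i⟩ ⟨c', j⟩
  by_cases h : c = 0 <;> by_cases h' : c' = 0 <;>
    simp [Matrix.mul_apply, zeroEmbedding, h, h', Ne.symm, Matrix.one_apply,
      eq_comm]

theorem partialTraceLeft_stack {m n : ℕ} (k : Fin m → Matrix (Fin n) (Fin n) ℂ)
    (ρ : Matrix (Fin n) (Fin n) ℂ) :
    partialTraceLeft (stack k * ρ * (stack k)ᴴ) = ∑ c, k c * ρ * (k c)ᴴ := by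
  ext i j
  simp [partialTraceLeft, Matrix.mul_apply, stack, Matrix.sum_apply]

theorem partialTraceLeft_of_mul_zeroEmbedding {m n : ℕ}
    {U : Matrix (Fin (m + 1) × Fin n) (Fin (m + 1) × Fin n) ℂ}
    {k : Fin (m + 1) → Matrix (Fin n) (Fin n) ℂ} (h : U * zeroEmbedding m n = stack k)
    (ρ : Matrix (Fin n) (Fin n) ℂ) :
    partialTraceLeft
        (U * (Matrix.single (0 : Fin (m + 1)) (0 : Fin (m + 1)) (1 : ℂ) ⊗ₖ ρ) * Uᴴ) =
      ∑ c, k c * ρ * (k c)ᴴ := by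
  rw [← partialTraceLeft_stack, ← zeroEmbedding_mul_mul_conjTranspose, ← h, conjTranspose_mul]
  simp only [Matrix.mul_assoc]

/-- A dilation is a unitary that sends `|0⟩ ⊗ x` to the stacked vector of all `k_c x`. The
compression of the stacked isometry to `|0⟩` is `k 0`, so the bound on `k 0` is what the extension
requires. -/
theorem exists_isDilation {m n : ℕ}
    {K : Matrix (Fin n) (Fin n) ℂ →ₗ[ℂ] Matrix (Fin n) (Fin n) ℂ}
    {k : Fin (m + 1) → Matrix (Fin n) (Fin n) ℂ} (hk1 : ∑ j, (k j)ᴴ * k j = 1)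
    (hk : ∀ ρ, K ρ = ∑ j, k j * ρ * (k j)ᴴ) {c : ℝ} (hc0 : 0 ≤ c) (hc1 : c ≤ 1)
    (h : ∀ x, c * (star x ⬝ᵥ x).re ≤ (star x ⬝ᵥ k 0 *ᵥ x).re) :
    ∃ U : Matrix (Fin (m + 1) × Fin n) (Fin (m + 1) × Fin n) ℂ,
      IsDilation K U ∧ unitaryCost U ≤ Real.arccos c := by
  have hJV := zeroEmbedding_conjTranspose_mul_stack k
  have hVJ : (stack k)ᴴ * zeroEmbedding m n = (k 0)ᴴ := by
    rw [← hJV, conjTranspose_mul, conjTranspose_conjTranspose]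
  have hV : (stack k)ᴴ * stack k = 1 := by rw [stack_conjTranspose_mul_stack, hk1]
  have hpos : ((zeroEmbedding m n)ᴴ * stack k + (stack k)ᴴ * zeroEmbedding m n -
      (2 * c : ℂ) • 1).PosSemidef := by
    rw [hJV, hVJ]
    refine PosSemidef.of_dotProduct_mulVec_nonneg ?_ fun x => ?_
    · have h2c : star (2 * c : ℂ) = 2 * c := by simp
      rw [IsHermitian, conjTranspose_sub, conjTranspose_add, conjTranspose_conjTranspose,
        conjTranspose_smul, conjTranspose_one, h2c, add_comm]
    · have h2 : star x ⬝ᵥ (k 0)ᴴ *ᵥ x = star (star x ⬝ᵥ k 0 *ᵥ x) := by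
        rw [star_dotProduct, star_mulVec, conjTranspose_conjTranspose, ← dotProduct_mulVec]
      have h3 : star x ⬝ᵥ x = ((star x ⬝ᵥ x).re : ℂ) :=
        Complex.eq_re_of_ofReal_le (r := 0) (by simp)
      rw [sub_mulVec, add_mulVec, dotProduct_sub, dotProduct_add, h2, smul_mulVec, one_mulVec,
        dotProduct_smul, RCLike.star_def, Complex.add_conj, smul_eq_mul, h3]
      have := h x
      exact_mod_cast (by linarith :
        0 ≤ 2 * (star x ⬝ᵥ k 0 *ᵥ x).re - 2 * c * (star x ⬝ᵥ x).re)
  obtain ⟨U, hU, hUJ, hspec⟩ := exists_unitary_extension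
    (zeroEmbedding_conjTranspose_mul_self m n) hV hc0 hc1 hpos
  exact ⟨U, ⟨hU, fun ρ => by rw [partialTraceLeft_of_mul_zeroEmbedding hUJ, hk]⟩,
    unitaryCost_le_arccos hspec⟩

/-! ### Unitary freedom of Kraus representations -/

theorem exists_unitary_row {m : ℕ} {u : Fin (m + 1) → ℂ} (hu : ∑ j, ‖u j‖ ^ 2 = 1) :
    ∃ W ∈ unitaryGroup (Fin (m + 1)) ℂ, W 0 = u := by
  have horth : Orthonormal ℂ (({0} : Set (Fin (m + 1))).domRestrict
      fun _ => WithLp.toLp 2 u) := by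
    refine ⟨fun i => ?_, fun i j hij => (hij (Subsingleton.elim i j)).elim⟩
    rw [Set.domRestrict_apply, EuclideanSpace.norm_eq, hu, Real.sqrt_one]
  obtain ⟨b, hb⟩ := horth.exists_orthonormalBasis_extension_of_card_eq (by simp)
  refine ⟨Matrix.of fun i j => b i j, ?_, ?_⟩
  · rw [mem_unitaryGroup_iff]
    ext i j
    have := orthonormal_iff_ite.1 b.orthonormal j i
    rw [PiLp.inner_apply] at this
    rw [Matrix.mul_apply, Matrix.one_apply]
    simpa [eq_comm, mul_comm] using this
  · ext j
    simp [hb 0 rfl]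

/-- Orthonormality of the columns of `W`, stated for an arbitrary `F` so that it serves both `∑ Kᴴ
K` and `∑ K ρ Kᴴ`. -/
theorem sum_unitary_mul_star_smul {ι M : Type*} [Fintype ι] [DecidableEq ι] [AddCommGroup M]
    [Module ℂ M] {W : Matrix ι ι ℂ} (hW : W ∈ unitaryGroup ι ℂ) (F : ι → ι → M) :
    ∑ i, ∑ j, ∑ j', (W i j * star (W i j')) • F j j' = ∑ j, F j j := by
  rw [Finset.sum_comm]
  refine Finset.sum_congr rfl fun j _ => ?_
  rw [Finset.sum_comm]
  have h (j' : ι) : ∑ i, (W i j * star (W i j')) • F j j' = if j' = j then F j j' else 0 := by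
    rw [← Finset.sum_smul]
    have := congrFun (congrFun (mem_unitaryGroup_iff'.1 hW) j') j
    rw [Matrix.mul_apply, Matrix.one_apply] at this
    simp only [star_apply, mul_comm (star _)] at this
    rw [this, ite_smul, one_smul, zero_smul]
  simp only [h, Finset.sum_ite_eq', Finset.mem_univ, if_true]

/-- Unitary freedom of Kraus representations, used to prescribe the first operator. -/
theorem exists_kraus_first {m n : ℕ} (k : Fin (m + 1) → Matrix (Fin n) (Fin n) ℂ)
    {u : Fin (m + 1) → ℂ} (hu : ∑ j, ‖u j‖ ^ 2 = 1) :
    ∃ l : Fin (m + 1) → Matrix (Fin n) (Fin n) ℂ, l 0 = ∑ j, u j • k j ∧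
      ∑ i, (l i)ᴴ * l i = ∑ j, (k j)ᴴ * k j ∧
      ∀ ρ, ∑ i, l i * ρ * (l i)ᴴ = ∑ j, k j * ρ * (k j)ᴴ := by
  obtain ⟨W, hW, rfl⟩ := exists_unitary_row hu
  refine ⟨fun i => ∑ j, W i j • k j, rfl, ?_, fun ρ => ?_⟩
  · rw [← sum_unitary_mul_star_smul hW fun j j' => (k j')ᴴ * k j]
    refine Finset.sum_congr rfl fun i _ => ?_
    rw [conjTranspose_sum, Finset.sum_mul_sum, Finset.sum_comm]
    refine Finset.sum_congr rfl fun j _ => Finset.sum_congr rfl fun j' _ => ?_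
    rw [conjTranspose_smul, smul_mul_smul_comm, mul_comm]
  · rw [← sum_unitary_mul_star_smul hW fun j j' => k j * ρ * (k j')ᴴ]
    refine Finset.sum_congr rfl fun i _ => ?_
    rw [conjTranspose_sum, Finset.sum_mul, Finset.sum_mul_sum]
    refine Finset.sum_congr rfl fun j _ => Finset.sum_congr rfl fun j' _ => ?_
    rw [conjTranspose_smul, Matrix.smul_mul, smul_mul_smul_comm]

/-! ### The minimizing state and its optimality condition -/

theorem exists_isMinOn_overlap {d n : ℕ} (hn : 0 < n) (k : Fin d → Matrix (Fin n) (Fin n) ℂ) :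
    ∃ Ψ₀ : Fin n × Fin n → ℂ, ∑ p, ‖Ψ₀ p‖ ^ 2 = 1 ∧
      ∀ ρ : Matrix (Fin n) (Fin n) ℂ, ρ.PosSemidef → ρ.trace = 1 →
        ∑ j, ‖overlap (k j) Ψ₀‖ ^ 2 ≤ ∑ j, ‖trace (k j * ρ)‖ ^ 2 := by
  -- An ancilla of dimension `n` purifies every state of `B`, so a minimizer on this one compact
  -- sphere is optimal among all states.
  obtain ⟨Ψ₀, h₀, hmin⟩ := (isCompact_unit_vectors (Fin n × Fin n)).exists_isMinOn
    ⟨Pi.single (⟨0, hn⟩, ⟨0, hn⟩) 1, by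
      rw [Set.mem_ofPred_eq, Finset.sum_eq_single (⟨0, hn⟩, ⟨0, hn⟩)]
      · simp
      · intro p _ hp
        simp [hp]
      · simp⟩
    (f := fun Ψ => ∑ j, ‖overlap (k j) Ψ‖ ^ 2)
    (continuous_finsetSum _ fun j _ => (continuous_overlap (k j)).norm.pow 2).continuousOn
  refine ⟨Ψ₀, h₀, fun ρ hρ htr => ?_⟩
  obtain ⟨Ψ, hΨ⟩ := exists_overlap_eq_trace hρ
  have h1 := hΨ 1
  rw [overlap_one, Matrix.one_mul, htr] at h1
  simp_rw [← hΨ]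
  exact hmin (show ∑ p, ‖Ψ p‖ ^ 2 = 1 by exact_mod_cast h1)

theorem posSemidef_sum_vecMulVec {ι κ : Type*} [Fintype ι] [Fintype κ] (Ψ : ι × κ → ℂ) :
    (∑ α, vecMulVec (fun i => Ψ (α, i)) (star fun i => Ψ (α, i))).PosSemidef :=
  posSemidef_sum _ fun _ _ => posSemidef_vecMulVec_self_star _

theorem trace_sum_vecMulVec {ι κ : Type*} [Fintype ι] [Fintype κ] [DecidableEq κ] {Ψ : ι × κ → ℂ}
    (hΨ : ∑ p, ‖Ψ p‖ ^ 2 = 1) :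
    (∑ α, vecMulVec (fun i => Ψ (α, i)) (star fun i => Ψ (α, i))).trace = 1 := by
  have := overlap_eq_trace 1 Ψ
  rw [overlap_one, hΨ, Matrix.one_mul] at this
  exact_mod_cast this.symm

/-- The optimality condition for a vector minimizing the entanglement fidelity: the set of all
`(tr (k_j ρ))_j` is convex, so it lies in a half-space bounded by the minimizer. -/
theorem sq_mul_le_re_of_isMinOn_overlap {ι κ : Type*} [Fintype ι] [Fintype κ] [DecidableEq κ]
    {k : ι → Matrix κ κ ℂ} {Ψ₀ : κ × κ → ℂ} (h₀ : ∑ p, ‖Ψ₀ p‖ ^ 2 = 1)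
    (hmin : ∀ ρ : Matrix κ κ ℂ, ρ.PosSemidef → ρ.trace = 1 →
        ∑ j, ‖overlap (k j) Ψ₀‖ ^ 2 ≤ ∑ j, ‖trace (k j * ρ)‖ ^ 2) (x : κ → ℂ) :
    (∑ j, ‖overlap (k j) Ψ₀‖ ^ 2) * (star x ⬝ᵥ x).re ≤
      (star x ⬝ᵥ (∑ j, star (overlap (k j) Ψ₀) • k j) *ᵥ x).re := by
  rcases eq_or_ne x 0 with rfl | hx
  · simp
  set s := (star x ⬝ᵥ x).re with hs
  have hspos : 0 < s := (Complex.lt_def.1 (dotProduct_star_self_pos_iff.2 hx)).1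
  have hsx : star x ⬝ᵥ x = (s : ℂ) := Complex.eq_re_of_ofReal_le (r := 0) (by simp)
  set ρ₀ := ∑ α, vecMulVec (fun i => Ψ₀ (α, i)) (star fun i => Ψ₀ (α, i)) with hρ₀
  -- The competitor is the normalized pure state along `x`; mixing it with `ρ₀` traces the segment
  -- from `w` to `z`.
  set ρ := ((s⁻¹ : ℝ) : ℂ) • vecMulVec x (star x) with hρ
  have hρpos : ρ.PosSemidef := (posSemidef_vecMulVec_self_star x).smul
    (by exact_mod_cast (inv_pos.2 hspos).le)
  have hρtr : ρ.trace = 1 := by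
    rw [hρ, trace_smul, trace_vecMulVec, dotProduct_comm, hsx, smul_eq_mul]
    exact_mod_cast inv_mul_cancel₀ hspos.ne'
  let w : EuclideanSpace ℂ ι := WithLp.toLp 2 fun j => overlap (k j) Ψ₀
  let z : EuclideanSpace ℂ ι := WithLp.toLp 2 fun j => trace (k j * ρ)
  have hw2 : ‖w‖ ^ 2 = ∑ j, ‖overlap (k j) Ψ₀‖ ^ 2 := EuclideanSpace.norm_sq_eq w
  have key : ‖w‖ ^ 2 ≤ inner ℝ w z := by
    refine norm_sq_le_inner_of_forall_norm_le fun t ht => ?_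
    have h1 := hmin (((1 - t : ℝ) : ℂ) • ρ₀ + ((t : ℝ) : ℂ) • ρ)
      (((posSemidef_sum_vecMulVec Ψ₀).smul (by exact_mod_cast sub_nonneg.2 ht.2)).add
        (hρpos.smul (by exact_mod_cast ht.1)))
      (by
        rw [trace_add, trace_smul, trace_smul, trace_sum_vecMulVec h₀, hρtr]
        push_cast
        simp)
    refine (sq_le_sq₀ (norm_nonneg _) (norm_nonneg _)).1 ?_
    rw [hw2, EuclideanSpace.norm_sq_eq]
    have hcoord (j : ι) : ((1 - t) • w + t • z) j =
        trace (k j * (((1 - t : ℝ) : ℂ) • ρ₀ + ((t : ℝ) : ℂ) • ρ)) := by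
      simp [w, z, overlap_eq_trace, Matrix.mul_add, hρ₀]
    simp_rw [hcoord]
    exact h1
  have hterm (j : ι) : trace (k j * ρ) = ((s⁻¹ : ℝ) : ℂ) * (star x ⬝ᵥ k j *ᵥ x) := by
    rw [hρ, Matrix.mul_smul, trace_smul, mul_vecMulVec, trace_vecMulVec, dotProduct_comm,
      smul_eq_mul]
  have hinner : inner ℝ w z =
      s⁻¹ * (star x ⬝ᵥ (∑ j, star (overlap (k j) Ψ₀) • k j) *ᵥ x).re := by
    rw [PiLp.inner_apply, sum_mulVec, dotProduct_sum, Complex.re_sum, Finset.mul_sum]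
    refine Finset.sum_congr rfl fun j _ => ?_
    simp only [w, z]
    rw [Complex.inner, hterm, smul_mulVec, dotProduct_smul, smul_eq_mul, mul_assoc,
      Complex.re_ofReal_mul, mul_comm (star _)]
    rfl
  rw [hw2, hinner, inv_mul_eq_div, le_div_iff₀ hspos] at key
  exact key

/-- A Kraus representation whose first operator certifies the minimal entanglement fidelity. -/
theorem exists_kraus_certificate {d n : ℕ} {k : Fin d → Matrix (Fin n) (Fin n) ℂ} {w : Fin d → ℂ}
    (h : ∀ x, (∑ j, ‖w j‖ ^ 2) * (star x ⬝ᵥ x).re ≤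
      (star x ⬝ᵥ (∑ j, star (w j) • k j) *ᵥ x).re) :
    ∃ l : Fin (d + 1) → Matrix (Fin n) (Fin n) ℂ,
      ∑ i, (l i)ᴴ * l i = ∑ j, (k j)ᴴ * k j ∧
      (∀ ρ, ∑ i, l i * ρ * (l i)ᴴ = ∑ j, k j * ρ * (k j)ᴴ) ∧
      ∀ x, √(∑ j, ‖w j‖ ^ 2) * (star x ⬝ᵥ x).re ≤ (star x ⬝ᵥ l 0 *ᵥ x).re := by
  set f := √(∑ j, ‖w j‖ ^ 2) with hf
  have hf2 : f ^ 2 = ∑ j, ‖w j‖ ^ 2 := Real.sq_sqrt (by positivity)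
  -- The added zero operator leaves the channel unchanged and can itself serve as first Kraus
  -- operator when `f = 0`.
  let k' : Fin (d + 1) → Matrix (Fin n) (Fin n) ℂ := Fin.cons 0 k
  have hpad (u : Fin (d + 1) → ℂ) (hu : ∑ j, ‖u j‖ ^ 2 = 1)
      (hx : ∀ x, f * (star x ⬝ᵥ x).re ≤ (star x ⬝ᵥ (∑ j, u j • k' j) *ᵥ x).re) :
      ∃ l : Fin (d + 1) → Matrix (Fin n) (Fin n) ℂ,
        ∑ i, (l i)ᴴ * l i = ∑ j, (k j)ᴴ * k j ∧
        (∀ ρ, ∑ i, l i * ρ * (l i)ᴴ = ∑ j, k j * ρ * (k j)ᴴ) ∧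
        ∀ x, f * (star x ⬝ᵥ x).re ≤ (star x ⬝ᵥ l 0 *ᵥ x).re := by
    obtain ⟨l, hl0, hl1, hl⟩ := exists_kraus_first k' hu
    refine ⟨l, ?_, fun ρ => ?_, fun x => by rw [hl0]; exact hx x⟩
    · rw [hl1, Fin.sum_univ_succ]
      simp [k']
    · rw [hl, Fin.sum_univ_succ]
      simp [k']
  rcases eq_or_ne f 0 with hf0 | hf0
  · refine hpad (Pi.single 0 1) ?_ fun x => ?_
    · rw [Fin.sum_univ_succ]
      simp
    · rw [Fin.sum_univ_succ]
      simp [k', hf0]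
  · have hfpos : 0 < f := lt_of_le_of_ne (Real.sqrt_nonneg _) hf0.symm
    -- The coefficients `conj w_j / f` form a unit vector, and division by `f` turns the bound `f²`
    -- into `f`.
    refine hpad (Fin.cons 0 fun j => ((f⁻¹ : ℝ) : ℂ) * star (w j)) ?_ fun x => ?_
    · rw [Fin.sum_univ_succ]
      simp only [Fin.cons_zero, Fin.cons_succ, norm_mul, norm_star, mul_pow, ← Finset.mul_sum,
        ← hf2, Complex.norm_real, Real.norm_eq_abs, sq_abs]
      simp [hf0]
    · have hsum : ∑ j, (Fin.cons 0 (fun j => ((f⁻¹ : ℝ) : ℂ) * star (w j)) :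
          Fin (d + 1) → ℂ) j • k' j = ((f⁻¹ : ℝ) : ℂ) • ∑ j, star (w j) • k j := by
        rw [Fin.sum_univ_succ]
        simp only [k', Fin.cons_zero, Fin.cons_succ, zero_smul, zero_add, mul_smul,
          Finset.smul_sum]
      have := h x
      rw [hsum, smul_mulVec, dotProduct_smul, smul_eq_mul, Complex.re_ofReal_mul, inv_mul_eq_div,
        le_div_iff₀ hfpos]
      rw [← hf2] at this
      linarith

/-- Completeness gives `2 - (l 0 + (l 0)ᴴ) = (1 - l 0)ᴴ (1 - l 0) + ∑ (l i)ᴴ (l i)`, the sum being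
over `i ≠ 0`, and the right side is positive. This later yields `f ≤ 1`. -/
theorem re_dotProduct_mulVec_le_of_kraus {m : ℕ} {κ : Type*} [Fintype κ] [DecidableEq κ]
    {l : Fin (m + 1) → Matrix κ κ ℂ} (hl : ∑ i, (l i)ᴴ * l i = 1) (x : κ → ℂ) :
    (star x ⬝ᵥ l 0 *ᵥ x).re ≤ (star x ⬝ᵥ x).re := by
  have hpos := (posSemidef_conjTranspose_mul_self (1 - l 0)).add
    (posSemidef_sum Finset.univ fun i _ => posSemidef_conjTranspose_mul_self (l (Fin.succ i)))
  have hcalc : (1 - l 0)ᴴ * (1 - l 0) + ∑ i, (l (Fin.succ i))ᴴ * l (Fin.succ i) =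
      (2 : ℝ) • 1 - (l 0 + (l 0)ᴴ) := by
    rw [Fin.sum_univ_succ] at hl
    rw [← eq_sub_iff_add_eq'] at hl
    rw [hl, conjTranspose_sub, conjTranspose_one]
    noncomm_ring
    module
  have h2 : star x ⬝ᵥ (l 0)ᴴ *ᵥ x = star (star x ⬝ᵥ l 0 *ᵥ x) := by
    rw [star_dotProduct, star_mulVec, conjTranspose_conjTranspose, ← dotProduct_mulVec]
  rw [hcalc] at hpos
  have h := (Complex.le_def.1 (hpos.dotProduct_mulVec_nonneg x)).1
  rw [sub_mulVec, add_mulVec, dotProduct_sub, dotProduct_add, h2, smul_mulVec, one_mulVec,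
    dotProduct_smul, RCLike.star_def, Complex.add_conj, Complex.sub_re, Complex.smul_re,
    Complex.ofReal_re, Complex.zero_re, smul_eq_mul] at h
  linarith

/-! ### Comparison of cost and fidelity -/

/-- The entanglement fidelity is bounded below by the cosine of the cost of any dilation. -/
theorem cos_unitaryCost_le_of_isDilation {m n a : ℕ}
    {K : Matrix (Fin n) (Fin n) ℂ →ₗ[ℂ] Matrix (Fin n) (Fin n) ℂ}
    {U : Matrix (Fin (m + 1) × Fin n) (Fin (m + 1) × Fin n) ℂ} (hU : IsDilation K U)
    {Ψ : Fin a × Fin n → ℂ} (hΨ : ∑ p, ‖Ψ p‖ ^ 2 = 1) :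
    Real.cos (unitaryCost U) ≤ fidelity (pureState Ψ) (idTensor a K (pureState Ψ)) := by
  -- The blocks of `U` in the column of `|0⟩` are Kraus operators of `K`.
  let l : Fin (m + 1) → Matrix (Fin n) (Fin n) ℂ := fun c =>
    Matrix.of fun i j => (U * zeroEmbedding m n) (c, i) j
  have hl : U * zeroEmbedding m n = stack l := rfl
  have hK : ∀ ρ, K ρ = ∑ j, l j * ρ * (l j)ᴴ := fun ρ => by
    rw [hU.2 ρ, partialTraceLeft_of_mul_zeroEmbedding hl]
  have hl0 (x : Fin n → ℂ) :
      Real.cos (unitaryCost U) * (star x ⬝ᵥ x).re ≤ (star x ⬝ᵥ l 0 *ᵥ x).re := by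
    have h1 := cos_unitaryCost_mul_le hU.1 (zeroEmbedding m n *ᵥ x)
    rwa [star_mulVec, ← dotProduct_mulVec, mulVec_mulVec, zeroEmbedding_conjTranspose_mul_self,
      one_mulVec, mulVec_mulVec, ← dotProduct_mulVec, mulVec_mulVec, hl,
      zeroEmbedding_conjTranspose_mul_stack] at h1
  rw [fidelity_idTensor hK hΨ]
  have h1 : Real.cos (unitaryCost U) ≤ (overlap (l 0) Ψ).re := by
    have h2 : overlap 1 Ψ = 1 := by rw [overlap_one, hΨ, Complex.ofReal_one]
    have h3 := congrArg Complex.re h2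
    rw [overlap, Complex.re_sum, Complex.one_re] at h3
    rw [overlap, Complex.re_sum, ← mul_one (Real.cos _), ← h3, Finset.mul_sum]
    refine Finset.sum_le_sum fun α _ => ?_
    rw [one_mulVec]
    exact hl0 _
  refine h1.trans ((Complex.re_le_norm _).trans (Real.le_sqrt_of_sq_le ?_))
  exact Finset.single_le_sum (f := fun j => ‖overlap (l j) Ψ‖ ^ 2) (fun _ _ => by positivity)
    (Finset.mem_univ 0)

end QuantumCost

end

/-- For every quantum channel `K` on a system of finite dimension `n ≥ 1`, both minima are
attained, and the minimum entanglement fidelity is `max (cos ‖K‖) 0`. -/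
theorem theorem1 {n : ℕ} (hn : 0 < n)
    (K : Matrix (Fin n) (Fin n) ℂ →ₗ[ℂ] Matrix (Fin n) (Fin n) ℂ)
    (hK : QuantumCost.IsQuantumChannel K) :
    IsLeast (QuantumCost.entanglementFidelities K) (QuantumCost.minEntanglementFidelity K) ∧
    IsLeast (QuantumCost.dilationCosts K) (QuantumCost.timeEnergyCost K) ∧
    QuantumCost.minEntanglementFidelity K =
      max (Real.cos (QuantumCost.timeEnergyCost K)) 0 := by
  open QuantumCost in
  obtain ⟨d, k, hk1, hk⟩ := hK
  obtain ⟨Ψ₀, h₀, hmin⟩ := exists_isMinOn_overlap hn k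
  obtain ⟨l, hl1, hl, hcert⟩ := exists_kraus_certificate
    (sq_mul_le_re_of_isMinOn_overlap h₀ hmin)
  set f := √(∑ j, ‖overlap (k j) Ψ₀‖ ^ 2) with hf
  have hf0 : 0 ≤ f := Real.sqrt_nonneg _
  have hfid : fidelity (pureState Ψ₀) (idTensor n K (pureState Ψ₀)) = f :=
    fidelity_idTensor hk h₀
  have hleastF : IsLeast (entanglementFidelities K) f := by
    refine ⟨⟨n, Ψ₀, h₀, hfid.symm⟩, ?_⟩
    rintro _ ⟨a, Ψ, hΨ, rfl⟩
    rw [fidelity_idTensor hk hΨ]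
    refine Real.sqrt_le_sqrt ?_
    simp_rw [overlap_eq_trace _ Ψ]
    exact hmin _ (posSemidef_sum_vecMulVec Ψ) (trace_sum_vecMulVec hΨ)
  have hlK : ∀ ρ, K ρ = ∑ j, l j * ρ * (l j)ᴴ := fun ρ => by rw [hk, hl]
  have hcos_le {m : ℕ} {U : Matrix (Fin (m + 1) × Fin n) (Fin (m + 1) × Fin n) ℂ}
      (hU : IsDilation K U) : Real.cos (unitaryCost U) ≤ f :=
    hfid ▸ cos_unitaryCost_le_of_isDilation hU h₀
  have hcost {m : ℕ} {U : Matrix (Fin (m + 1) × Fin n) (Fin (m + 1) × Fin n) ℂ}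
      (hU : IsDilation K U) : Real.arccos f ≤ unitaryCost U := by
    rw [← Real.arccos_cos (unitaryCost_nonneg U) (unitaryCost_le_pi U)]
    exact Real.arccos_le_arccos (hcos_le hU)
  -- A basis vector, available as `n > 0`, is squeezed between the certificate and the upper bound
  -- on the first Kraus operator.
  have hf1 : f ≤ 1 := by
    have h1 := (hcert (Pi.single ⟨0, hn⟩ 1)).trans
      (re_dotProduct_mulVec_le_of_kraus (hl1.trans hk1) _)
    simpa using h1
  obtain ⟨U, hU, hUcost⟩ := exists_isDilation (hl1.trans hk1) hlK hf0 hf1 hcert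
  have hleastU : IsLeast (dilationCosts K) (Real.arccos f) := by
    refine ⟨⟨d, U, hU, le_antisymm (hcost hU) hUcost⟩, ?_⟩
    rintro _ ⟨m, U', hU', rfl⟩
    exact hcost hU'
  have hF : minEntanglementFidelity K = f := hleastF.csInf_eq
  have hC : timeEnergyCost K = Real.arccos f := hleastU.csInf_eq
  refine ⟨hF ▸ hleastF, hC ▸ hleastU, ?_⟩
  rw [hF, hC, Real.cos_arccos (by linarith) hf1, max_eq_left hf0]
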